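/- **Theorem (Optimal Embeddings and Their Structure for Multi-Block Cyclic-Shift Groups).** Let $\Pi\in\mathbb R^{m\times m}$ be the cyclic-shift matrix, $\Pi(x_1,\dots,x_m)^\top=(x_m,x_1,\dots,x_{m-1})^\top$; call $A\in\mathbb R^{m\times m}$ circulant if $A_{:,j}=\Pi^{j-1}\boldsymbol a$ ($j=1,\dots,m$) for some $\boldsymbol a\in\mathbb R^m$. Let $\sigma(\boldsymbol u)_k=e^{u_k}/\sum_l e^{u_l}$ be the softmax, $\mathcal L(\boldsymbol q,\boldsymbol p)=-\sum_k p_k\log q_k$ the cross-entropy, $\|\cdot\|_F$ the Frobenius norm and $\|\cdot\|_*$ the nuclear norm (the sum of the singular values). Let $\boldsymbol y_1,\dots,\boldsymbol y_b\in\mathbb R^m$ be probability vectors, at least one of them different from $(1/m,\dots,1/m)^\top$, and let $Y=[Y_1|\cdots|Y_b]\in\mathbb R^{m\times bm}$, where the columns of $Y_i$ are the $m$ vectors $\boldsymbol y_i,\Pi\boldsymbol y_i,\dots,\Pi^{m-1}\boldsymbol y_i$ in some order: $(Y_i)_{:,j}=\Pi^{\tau_i(j)-1}\boldsymbol y_i$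 with a permutation $\tau_i$ of $\{1,\dots,m\}$. (The natural order is $\tau_i=\mathrm{id}$.) Let $d\ge m$ and $E_W,E_H>0$, and consider $$\min_{W\in\mathbb R^{m\times d},\,H\in\mathbb R^{d\times bm}}\ \sum_{j=1}^{bm}\mathcal L\big(\sigma((WH)_{:,j}),Y_{:,j}\big)\quad\text{s.t.}\quad \|W\|_F^2\le E_W,\ \|H\|_F^2\le E_H .$$ Assume that the constraints are active, i.e. every minimizer satisfies $\|W\|_F^2=E_W$ and $\|H\|_F^2=E_H$. Then every minimizer $(W^*,H^*)$, with logit matrix $Z^*=W^*H^*=[Z_1^*|\cdots|Z_b^*]$, has the following properties. 1. There are $\boldsymbol z_1^*,\dots,\boldsymbol z_b^*\in\mathbb R^m$ with $(Z_i^*)_{:,j}=\Pi^{\tau_i(j)-1}\boldsymbol z_i^*$ for all $i,j$ (so $Z_i^*$ is circulant when $\tau_i=\mathrm{id}$), and $(\boldsymbol z_1^*,\dots,\boldsymbol z_b^*)$ is a solution of $$\min_{\boldsymbol z_1,\dots,\boldsymbol z_b\in\mathbb R^m}\ \sum_{i=1}^b\mathcal L(\sigma(\boldsymbol z_i),\boldsymbol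 y_i)\quad\text{s.t.}\quad\big\|\,[\,[\Pi^{j-1}\boldsymbol z_1]_{j=1}^m|\cdots|[\Pi^{j-1}\boldsymbol z_b]_{j=1}^m\,]\,\big\|_*\le\sqrt{E_WE_H}.$$ This is a convex program: its objective is a convex function and its constraint set is convex. 2. $W^*(W^*)^\top=\sqrt{E_W/E_H}\,\big(Z^*(Z^*)^\top\big)^{1/2}$, with the positive semidefinite square root, and this matrix is circulant. -/

import Mathlib

open scoped MatrixOrder

noncomputable section

namespace LayerPeeled

/-- The softmax of a vector, `σ(u)ₖ = exp uₖ / ∑ₗ exp uₗ`. -/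
def softmax {m : ℕ} (u : Fin m → ℝ) : Fin m → ℝ :=
  fun k => Real.exp (u k) / ∑ l, Real.exp (u l)

/-- The cross-entropy loss `ℒ(q, p) = -∑ₖ pₖ log qₖ` (prediction `q`, target `p`). -/
def crossEntropy {m : ℕ} (q p : Fin m → ℝ) : ℝ :=
  -∑ k, p k * Real.log (q k)

/-- The squared Frobenius norm of a real matrix. -/
def frobeniusSq {ι κ : Type*} [Fintype ι] [Fintype κ] (A : Matrix ι κ ℝ) : ℝ :=
  ∑ i, ∑ j, A i j ^ 2

/-- The nuclear norm of a real matrix: the sum of its singular values. -/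
def nuclearNorm {ι κ : Type*} [Fintype ι] [Fintype κ] [DecidableEq κ]
    (A : Matrix ι κ ℝ) : ℝ :=
  (Matrix.toEuclideanLin A).singularValues.sum fun _ s => s

/-- The objective `𝒥(W, H; Y) = ∑ⱼ ℒ(σ((W H)_{:,j}), Y_{:,j})`. -/
def objective {m d : ℕ} {κ : Type*} [Fintype κ] (Y : Matrix (Fin m) κ ℝ)
    (W : Matrix (Fin m) (Fin d) ℝ) (H : Matrix (Fin d) κ ℝ) : ℝ :=
  ∑ j, crossEntropy (softmax ((W * H).col j)) (Y.col j)

/-- The pairs `(W, H)` with `‖W‖_F² ≤ E_W` and `‖H‖_F² ≤ E_H`. -/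
def feasible (m d : ℕ) (κ : Type*) [Fintype κ] (EW EH : ℝ) :
    Set (Matrix (Fin m) (Fin d) ℝ × Matrix (Fin d) κ ℝ) :=
  {p | frobeniusSq p.1 ≤ EW ∧ frobeniusSq p.2 ≤ EH}

/-- `(W, H)` is a global minimizer of the constrained layer-peeled program with target `Y`. -/
def IsMinimizer {m d : ℕ} {κ : Type*} [Fintype κ] (Y : Matrix (Fin m) κ ℝ) (EW EH : ℝ)
    (W : Matrix (Fin m) (Fin d) ℝ) (H : Matrix (Fin d) κ ℝ) : Prop :=
  (W, H) ∈ feasible m d κ EW EH ∧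
    IsMinOn (fun p => objective Y p.1 p.2) (feasible m d κ EW EH) (W, H)

/-- The active-constraints assumption: both budgets are positive, and both norm constraints hold
with equality at every minimizer. -/
def ActiveConstraints {m : ℕ} (d : ℕ) {κ : Type*} [Fintype κ] (Y : Matrix (Fin m) κ ℝ)
    (EW EH : ℝ) : Prop :=
  0 < EW ∧ 0 < EH ∧
    ∀ (W : Matrix (Fin m) (Fin d) ℝ) (H : Matrix (Fin d) κ ℝ),
      IsMinimizer Y EW EH W H → frobeniusSq W = EW ∧ frobeniusSq H = EH

/-- The one-step cyclic-shift matrix `Π`, `Π (y₁, …, yₘ)ᵀ = (yₘ, y₁, …, yₘ₋₁)ᵀ`. -/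
def cyclicShift (m : ℕ) : Matrix (Fin m) (Fin m) ℝ :=
  Matrix.of fun i j => if (i : ℕ) = ((j : ℕ) + 1) % m then 1 else 0

/-- A matrix is circulant if its columns are `a, Π a, …, Π ^ (m - 1) a` for some vector `a`. -/
def IsCirculant {m : ℕ} (A : Matrix (Fin m) (Fin m) ℝ) : Prop :=
  ∃ a : Fin m → ℝ, ∀ j : Fin m, A.col j = Matrix.mulVec (cyclicShift m ^ (j : ℕ)) a

/-- The concatenation of the cyclic-shift orbits of `x₁, …, x_b`. The columns of block `i` are the
`m` vectors `x i, Π (x i), …, Π ^ (m - 1) (x i)`, listed in the order `τ i`: column `(i, j)` is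
`Π ^ (τ i j) (x i)`. For `τ i = 1` block `i` is the circulant matrix generated by `x i`. -/
def orbitBlocks {m b : ℕ} (τ : Fin b → Equiv.Perm (Fin m)) (x : Fin b → Fin m → ℝ) :
    Matrix (Fin m) (Fin b × Fin m) ℝ :=
  Matrix.of fun k c => Matrix.mulVec (cyclicShift m ^ (τ c.1 c.2 : ℕ)) (x c.1) k

/-- The block-circulant matrix `[[Π ^ (j-1) z₁]ⱼ | ⋯ | [Π ^ (j-1) z_b]ⱼ]`. -/
def blockCirculant {m b : ℕ} (z : Fin b → Fin m → ℝ) : Matrix (Fin m) (Fin b × Fin m) ℝ :=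
  orbitBlocks (fun _ => 1) z

/-- The objective of the reduced program: `∑ᵢ ℒ(σ(zᵢ), yᵢ)`. -/
def reducedObjective {m b : ℕ} (y z : Fin b → Fin m → ℝ) : ℝ :=
  ∑ i, crossEntropy (softmax (z i)) (y i)

/-- The constraint set of the reduced program: the generating vectors whose block-circulant matrix
has nuclear norm at most `√(E_W E_H)`. -/
def reducedFeasible (m b : ℕ) (EW EH : ℝ) : Set (Fin b → Fin m → ℝ) :=
  {z | nuclearNorm (blockCirculant z) ≤ √(EW * EH)}

end LayerPeeled

end

/-! Since `m ≤ d`, the products `W * H` of feasible pairs fill exactly the ball of nuclear norm at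
most `√(EW * EH)` (`nuclearNorm_mul_le`, `exists_factorization_of_nuclearNorm_le`), so the program
is convex in the logits. Softmax cross-entropy is strictly convex up to adding a constant to a
column. Active constraints remove this freedom: centring the columns of `W` keeps the loss and would
otherwise lower the norm of `W`. Hence the optimal logit matrix is unique
(`IsMinimizer.mul_eq_mul`). A cyclic shift of the rows with a matching permutation of the columns
fixes `Y` and sends minimizers to minimizers, so it fixes the logits too. This invariance is the
orbit form, and the reduced program is the restriction to matrices of that form.

For the Gram matrix, let `Q` be the partial isometry in the polar decomposition of `W * H` and `t =
√(EW / EH)`. The squared norm of `Wᵀ - t H Qᵀ` is at most `2t` times the slack in the nuclear norm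
bound, and activity makes this slack zero. So `Wᵀ = t H Qᵀ`, which gives the formula for `W Wᵀ`;
uniqueness of the square root carries the shift invariance over to it. -/

namespace LayerPeeled

/-! ### Frobenius norm, polar decomposition and the nuclear norm as a trace. -/

section LinearAlgebra

variable {ι κ μ : Type*} [Fintype ι] [Fintype κ] [Fintype μ]

theorem frobeniusSq_eq_trace (A : Matrix ι κ ℝ) :
    frobeniusSq A = (A * A.transpose).trace := by
  simp [frobeniusSq, Matrix.trace, Matrix.mul_apply, sq]

theorem frobeniusSq_eq_trace_transpose_mul (A : Matrix ι κ ℝ) :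
    frobeniusSq A = (A.transpose * A).trace := by
  rw [frobeniusSq_eq_trace, Matrix.trace_mul_comm]

theorem frobeniusSq_nonneg (A : Matrix ι κ ℝ) : 0 ≤ frobeniusSq A := by
  unfold frobeniusSq; positivity

theorem frobeniusSq_eq_zero {A : Matrix ι κ ℝ} (h : frobeniusSq A = 0) : A = 0 := by
  rw [frobeniusSq, Finset.sum_eq_zero_iff_of_nonneg fun i _ => by positivity] at h
  ext i j
  have := h i (Finset.mem_univ _)
  rw [Finset.sum_eq_zero_iff_of_nonneg fun i _ => by positivity] at this
  simpa using this j (Finset.mem_univ _)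

theorem frobeniusSq_transpose (A : Matrix ι κ ℝ) : frobeniusSq A.transpose = frobeniusSq A := by
  rw [frobeniusSq_eq_trace_transpose_mul, Matrix.transpose_transpose, frobeniusSq_eq_trace]

theorem frobeniusSq_smul (c : ℝ) (A : Matrix ι κ ℝ) :
    frobeniusSq (c • A) = c ^ 2 * frobeniusSq A := by
  simp [frobeniusSq, Finset.mul_sum, mul_pow]

theorem frobeniusSq_sub_smul (A B : Matrix ι κ ℝ) (c : ℝ) :
    frobeniusSq (A - c • B) =
      frobeniusSq A - 2 * c * (A * B.transpose).trace + c ^ 2 * frobeniusSq B := by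
  simp only [frobeniusSq, Matrix.trace, Matrix.diag_apply, Matrix.mul_apply, Finset.mul_sum,
    ← Finset.sum_sub_distrib, ← Finset.sum_add_distrib, Matrix.sub_apply, Matrix.smul_apply,
    Matrix.transpose_apply, smul_eq_mul]
  exact Finset.sum_congr rfl fun i _ => Finset.sum_congr rfl fun j _ => by ring

theorem mul_transpose_self_nonneg [DecidableEq ι] (Z : Matrix ι κ ℝ) : 0 ≤ Z * Z.transpose := by
  rw [Matrix.nonneg_iff_posSemidef]
  simpa using Matrix.posSemidef_self_mul_conjTranspose Z

theorem transpose_eq_of_nonneg {ι : Type*} {S : Matrix ι ι ℝ} (hS : 0 ≤ S) : S.transpose = S := by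
  have := (Matrix.nonneg_iff_posSemidef.1 hS).1
  simpa [Matrix.IsHermitian] using this

/-- A symmetric matrix has a symmetric generalized inverse that commutes with it. -/
theorem exists_symm_generalized_inverse [DecidableEq ι] {S : Matrix ι ι ℝ}
    (hS : S.transpose = S) :
    ∃ R : Matrix ι ι ℝ, R.transpose = R ∧ S * R = R * S ∧ S * R * S = S ∧ R * S * R = R := by
  have hsa : IsSelfAdjoint S := by
    simpa [IsSelfAdjoint, Matrix.star_eq_conjTranspose] using hS
  have hc (f : ℝ → ℝ) : ContinuousOn f (spectrum ℝ S) :=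
    (Matrix.finite_real_spectrum (A := S)).continuousOn f
  have hid : cfc (fun x : ℝ => x) S = S := cfc_id' ℝ S
  -- The convention `0⁻¹ = 0` makes this the pseudoinverse when `S` is singular.
  refine ⟨cfc (fun x : ℝ => x⁻¹) S, ?_, ?_, ?_, ?_⟩
  · have : IsSelfAdjoint (cfc (fun x : ℝ => x⁻¹) S) := cfc_predicate _ _
    simpa [IsSelfAdjoint, Matrix.star_eq_conjTranspose] using this
  · have := cfc_commute_cfc (fun x : ℝ => x) (fun x : ℝ => x⁻¹) S
    rw [hid] at this
    exact this
  · have h1 := cfc_mul (fun x : ℝ => x) (fun x : ℝ => x⁻¹) S (hc _) (hc _)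
    have h2 := cfc_mul (fun x : ℝ => x * x⁻¹) (fun x : ℝ => x) S (hc _) (hc _)
    rw [h1] at h2
    simp only [mul_inv_mul_cancel, hid] at h2
    exact h2.symm
  · have h1 := cfc_mul (fun x : ℝ => x⁻¹) (fun x : ℝ => x) S (hc _) (hc _)
    have h2 := cfc_mul (fun x : ℝ => x⁻¹ * x) (fun x : ℝ => x⁻¹) S (hc _) (hc _)
    rw [h1] at h2
    have h3 : (fun x : ℝ => x⁻¹ * x * x⁻¹) = fun x => x⁻¹ := by
      funext x; rcases eq_or_ne x 0 with rfl | hx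
      · simp
      · field_simp
    simp only [h3, hid] at h2
    exact h2.symm

/-- Polar decomposition: `Z = S Q` with `S = (Z Zᵀ)^{1/2}` and a partial isometry `Q`. -/
theorem exists_polar [DecidableEq ι] (Z : Matrix ι κ ℝ) :
    ∃ Q : Matrix ι κ ℝ, Z * Q.transpose = CFC.sqrt (Z * Z.transpose) ∧
      CFC.sqrt (Z * Z.transpose) * Q = Z ∧ Q * Q.transpose * Q = Q := by
  have hSS : CFC.sqrt (Z * Z.transpose) * CFC.sqrt (Z * Z.transpose) = Z * Z.transpose :=
    CFC.sqrt_mul_sqrt_self _ (mul_transpose_self_nonneg Z)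
  have hSt := transpose_eq_of_nonneg (CFC.sqrt_nonneg (Z * Z.transpose))
  set S := CFC.sqrt (Z * Z.transpose)
  obtain ⟨R, hR, hcomm, h1, h2⟩ := exists_symm_generalized_inverse hSt
  have hSSR : S * (S * R) = S := by rw [hcomm, ← Matrix.mul_assoc, h1]
  refine ⟨R * Z, ?_, ?_, ?_⟩
  · rw [Matrix.transpose_mul, hR, ← Matrix.mul_assoc, ← hSS, Matrix.mul_assoc, hSSR]
  -- The difference is `(S R - 1) Z`, and `(S R - 1) Z Zᵀ = (S R - 1) S S = 0`.
  · have h0 : frobeniusSq (S * (R * Z) - Z) = 0 := by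
      rw [frobeniusSq_eq_trace]
      have : (S * (R * Z) - Z) * (S * (R * Z) - Z).transpose = 0 := by
        have e : S * (R * Z) - Z = (S * R - 1) * Z := by
          rw [Matrix.sub_mul, Matrix.mul_assoc, Matrix.one_mul]
        have e2 : (S * R - 1) * S = 0 := by rw [Matrix.sub_mul, h1, Matrix.one_mul, sub_self]
        rw [e, Matrix.transpose_mul, Matrix.mul_assoc, ← Matrix.mul_assoc Z, ← hSS,
          Matrix.mul_assoc S S, ← Matrix.mul_assoc, e2, Matrix.zero_mul]
      rw [this, Matrix.trace_zero]
    exact sub_eq_zero.1 (frobeniusSq_eq_zero h0)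
  · have e : R * Z * (R * Z).transpose = R * S := by
      rw [Matrix.transpose_mul, hR, Matrix.mul_assoc, ← Matrix.mul_assoc Z, ← hSS,
        Matrix.mul_assoc S S, hSSR]
    rw [e, ← Matrix.mul_assoc, h2]

/-- Pythagoras: `Qᵀ Q` is an orthogonal projection, and the gap is the squared norm of `H - H Qᵀ Q`.
-/
theorem frobeniusSq_mul_transpose_le {Q : Matrix ι κ ℝ} (hQ : Q * Q.transpose * Q = Q)
    (H : Matrix μ κ ℝ) : frobeniusSq (H * Q.transpose) ≤ frobeniusSq H := by
  have hQ' : Q.transpose * Q * Q.transpose = Q.transpose := by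
    simpa [Matrix.mul_assoc] using congrArg Matrix.transpose hQ
  have h := frobeniusSq_sub_smul H (H * Q.transpose * Q) 1
  have e1 : (H * (H * Q.transpose * Q).transpose).trace = frobeniusSq (H * Q.transpose) := by
    rw [frobeniusSq_eq_trace]
    simp [Matrix.mul_assoc]
  have e2 : frobeniusSq (H * Q.transpose * Q) = frobeniusSq (H * Q.transpose) := by
    rw [frobeniusSq_eq_trace, frobeniusSq_eq_trace]
    simp only [Matrix.transpose_mul, Matrix.transpose_transpose]
    have : H * Q.transpose * Q * (Q.transpose * (Q * H.transpose)) =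
        H * (Q.transpose * Q * Q.transpose) * (Q * H.transpose) := by
      simp only [Matrix.mul_assoc]
    rw [this, hQ']
  rw [e1, e2] at h
  have := frobeniusSq_nonneg (H - (1 : ℝ) • (H * Q.transpose * Q))
  linarith

theorem trace_cfc_sqrt [DecidableEq κ] {A : Matrix κ κ ℝ} (hA : A.PosSemidef) :
    (CFC.sqrt A).trace = ∑ i, √(hA.1.eigenvalues i) := by
  rw [CFC.sqrt_eq_real_sqrt A (Matrix.nonneg_iff_posSemidef.2 hA), cfcₙ_eq_cfc,
    hA.1.cfc_eq, Matrix.IsHermitian.cfc, Unitary.conjStarAlgAut_apply, Matrix.trace_mul_cycle,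
    Unitary.coe_star_mul_self, Matrix.one_mul, Matrix.trace_diagonal]
  simp

theorem nuclearNorm_eq_trace_sqrt_transpose_mul [DecidableEq κ] (Z : Matrix ι κ ℝ) :
    nuclearNorm Z = (CFC.sqrt (Z.transpose * Z)).trace := by
  classical
  have hA : (Z.transpose * Z).PosSemidef := by
    simpa using Matrix.posSemidef_conjTranspose_mul_self Z
  rw [trace_cfc_sqrt hA]
  have hT : (Matrix.toEuclideanLin Z).adjoint ∘ₗ Matrix.toEuclideanLin Z =
      Matrix.toEuclideanLin (Z.transpose * Z) := by
    rw [← Matrix.toEuclideanLin_conjTranspose_eq_adjoint, Matrix.conjTranspose_eq_transpose_of_trivial]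
    ext x i
    simp [Matrix.toLpLin_apply]
  have hn : Module.finrank ℝ (EuclideanSpace ℝ κ) = Fintype.card κ := finrank_euclideanSpace
  have h0 : ∀ i : Fin (Fintype.card κ),
      (Matrix.toEuclideanLin Z).singularValues i = √(hA.1.eigenvalues₀ i) := by
    intro i
    rw [LinearMap.singularValues_fin _ hn]
    unfold Matrix.IsHermitian.eigenvalues₀
    congr 3
  have h1 : nuclearNorm Z = ∑ i : Fin (Fintype.card κ), √(hA.1.eigenvalues₀ i) := by
    rw [nuclearNorm, Finsupp.sum_of_support_subset (s := Finset.range (Fintype.card κ))]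
    · rw [Finset.sum_range]
      exact Finset.sum_congr rfl fun i _ => h0 i
    · intro i hi
      rw [Finset.mem_range]
      by_contra hlt
      exact Finsupp.mem_support_iff.1 hi
        (LinearMap.singularValues_of_finrank_le _ (by rw [hn]; omega))
    · simp
  rw [h1]
  unfold Matrix.IsHermitian.eigenvalues
  exact ((Fintype.equivOfCardEq (Fintype.card_fin _)).symm.sum_comp
    fun i => √(hA.1.eigenvalues₀ i)).symm

/-- With `Z = S Q`, the square root of `Zᵀ Z` is `Qᵀ S Q`, which has the same trace as `S`. -/
theorem nuclearNorm_eq_trace_sqrt [DecidableEq ι] [DecidableEq κ] (Z : Matrix ι κ ℝ) :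
    nuclearNorm Z = (CFC.sqrt (Z * Z.transpose)).trace := by
  obtain ⟨Q, h1, h2, h3⟩ := exists_polar Z
  have hS := CFC.sqrt_nonneg (Z * Z.transpose)
  have hSt := transpose_eq_of_nonneg hS
  set S := CFC.sqrt (Z * Z.transpose)
  have hSQ : S * Q * Q.transpose = S := by rw [h2, h1]
  have h : CFC.sqrt (Z.transpose * Z) = Q.transpose * S * Q := by
    apply CFC.sqrt_unique
    · calc Q.transpose * S * Q * (Q.transpose * S * Q)
          = Q.transpose * (S * Q * Q.transpose) * (S * Q) := by simp only [Matrix.mul_assoc]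
        _ = (S * Q).transpose * (S * Q) := by rw [hSQ, Matrix.transpose_mul, hSt]
        _ = Z.transpose * Z := by rw [h2]
    · rw [Matrix.nonneg_iff_posSemidef] at hS ⊢
      simpa using hS.conjTranspose_mul_mul_same Q
  rw [nuclearNorm_eq_trace_sqrt_transpose_mul, h, Matrix.mul_assoc, Matrix.trace_mul_comm, hSQ]

end LinearAlgebra

end LayerPeeled

namespace LayerPeeled

/-! ### Nuclear norm balls as sets of bounded factorizations. -/

section Factorization

variable {ι κ μ : Type*} [Fintype ι] [Fintype κ] [Fintype μ]

theorem sqrt_div_mul_sqrt_mul {a b : ℝ} (ha : 0 < a) (hb : 0 < b) :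
    √(a / b) * √(a * b) = a := by
  rw [← Real.sqrt_mul (by positivity), show a / b * (a * b) = a * a by field_simp,
    Real.sqrt_mul_self ha.le]

theorem sqrt_div_sq_mul {a b : ℝ} (ha : 0 < a) (hb : 0 < b) : √(a / b) ^ 2 * b = a := by
  rw [Real.sq_sqrt (by positivity)]; field_simp

/-- The partial isometry of the polar decomposition of `W H` controls `Wᵀ - t H Qᵀ`. -/
theorem frobeniusSq_transpose_sub_le [DecidableEq ι] [DecidableEq κ] {EW EH : ℝ} (hEW : 0 < EW)
    (hEH : 0 < EH) {W : Matrix ι μ ℝ} {H : Matrix μ κ ℝ} (hW : frobeniusSq W ≤ EW)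
    (hH : frobeniusSq H ≤ EH) {Q : Matrix ι κ ℝ}
    (hQ : W * H * Q.transpose = CFC.sqrt (W * H * (W * H).transpose))
    (hQQ : Q * Q.transpose * Q = Q) :
    frobeniusSq (W.transpose - √(EW / EH) • (H * Q.transpose)) ≤
      2 * √(EW / EH) * (√(EW * EH) - nuclearNorm (W * H)) := by
  have h1 : (W.transpose * (H * Q.transpose).transpose).trace = nuclearNorm (W * H) := by
    rw [nuclearNorm_eq_trace_sqrt, ← hQ, ← Matrix.transpose_mul, Matrix.trace_transpose,
      Matrix.trace_mul_comm, Matrix.mul_assoc]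
  have h2 := (frobeniusSq_mul_transpose_le hQQ H).trans hH
  rw [frobeniusSq_sub_smul, h1, frobeniusSq_transpose]
  have h3 := sqrt_div_mul_sqrt_mul hEW hEH
  have h4 := sqrt_div_sq_mul hEW hEH
  have h5 := mul_le_mul_of_nonneg_left h2 (sq_nonneg √(EW / EH))
  linarith

theorem nuclearNorm_mul_le [DecidableEq ι] [DecidableEq κ] {EW EH : ℝ} (hEW : 0 < EW)
    (hEH : 0 < EH) {W : Matrix ι μ ℝ} {H : Matrix μ κ ℝ} (hW : frobeniusSq W ≤ EW)
    (hH : frobeniusSq H ≤ EH) : nuclearNorm (W * H) ≤ √(EW * EH) := by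
  obtain ⟨Q, h1, -, h3⟩ := exists_polar (W * H)
  have h := (frobeniusSq_nonneg _).trans (frobeniusSq_transpose_sub_le hEW hEH hW hH h1 h3)
  have ht : 0 < 2 * √(EW / EH) := by positivity
  exact sub_nonneg.1 (nonneg_of_mul_nonneg_right h ht)

theorem mul_transpose_eq_of_nuclearNorm_eq [DecidableEq ι] [DecidableEq κ] {EW EH : ℝ}
    (hEW : 0 < EW) (hEH : 0 < EH) {W : Matrix ι μ ℝ} {H : Matrix μ κ ℝ}
    (hW : frobeniusSq W ≤ EW) (hH : frobeniusSq H ≤ EH)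
    (h : nuclearNorm (W * H) = √(EW * EH)) :
    W * W.transpose = √(EW / EH) • CFC.sqrt (W * H * (W * H).transpose) := by
  obtain ⟨Q, h1, -, h3⟩ := exists_polar (W * H)
  have h0 := frobeniusSq_transpose_sub_le hEW hEH hW hH h1 h3
  rw [h, sub_self, mul_zero] at h0
  have := sub_eq_zero.1 (frobeniusSq_eq_zero (h0.antisymm (frobeniusSq_nonneg _)))
  rw [this, Matrix.mul_smul, ← Matrix.mul_assoc, h1]

/-- A balanced factorization of `Z` through any space containing a copy of the row space. -/
theorem exists_factorization [DecidableEq ι] [DecidableEq κ] [DecidableEq μ] (e : ι ↪ μ)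
    (Z : Matrix ι κ ℝ) {t : ℝ} (ht : 0 < t) :
    ∃ (W : Matrix ι μ ℝ) (H : Matrix μ κ ℝ), W * H = Z ∧
      frobeniusSq W = t * nuclearNorm Z ∧ frobeniusSq H = t⁻¹ * nuclearNorm Z := by
  obtain ⟨Q, h1, h2, h3⟩ := exists_polar Z
  have hTT := CFC.sqrt_mul_sqrt_self _ (CFC.sqrt_nonneg (Z * Z.transpose))
  have hTt := transpose_eq_of_nonneg (CFC.sqrt_nonneg (CFC.sqrt (Z * Z.transpose)))
  rw [nuclearNorm_eq_trace_sqrt]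
  set S := CFC.sqrt (Z * Z.transpose)
  set T := CFC.sqrt S
  let J : Matrix ι μ ℝ := Matrix.of fun i k => if e i = k then 1 else 0
  have hJ : J * J.transpose = 1 := by
    ext i j
    simp [J, Matrix.mul_apply, Matrix.one_apply, eq_comm]
  have hJ' (A : Matrix ι κ ℝ) : J * (J.transpose * A) = A := by
    rw [← Matrix.mul_assoc, hJ, Matrix.one_mul]
  have hs : √t ^ 2 = t := Real.sq_sqrt ht.le
  -- `Z = T (T Q)` with `T = S^{1/2}` splits the nuclear norm evenly; `J` pads to the inner
  -- dimension and `√t` rebalances.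
  refine ⟨√t • (T * J), (√t)⁻¹ • (J.transpose * (T * Q)), ?_, ?_, ?_⟩
  · rw [Matrix.smul_mul, Matrix.mul_smul, smul_smul, mul_inv_cancel₀ (by positivity), one_smul,
      Matrix.mul_assoc, hJ', ← Matrix.mul_assoc, hTT, h2]
  · rw [frobeniusSq_smul, hs, frobeniusSq_eq_trace, Matrix.transpose_mul, Matrix.mul_assoc,
      ← Matrix.mul_assoc J, hJ, Matrix.one_mul, hTt, hTT]
  · rw [frobeniusSq_smul, inv_pow, hs, frobeniusSq_eq_trace_transpose_mul, Matrix.transpose_mul,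
      Matrix.transpose_transpose, Matrix.mul_assoc, hJ', Matrix.transpose_mul, hTt,
      Matrix.mul_assoc, ← Matrix.mul_assoc T, hTT, Matrix.trace_mul_comm, h2, h1]

/-- The ratio `t = √(EW / EH)` uses both budgets in the same proportion, so a saturated `W` forces a
saturated nuclear norm. -/
theorem exists_factorization_of_nuclearNorm_le [DecidableEq ι] [DecidableEq κ] [DecidableEq μ]
    {EW EH : ℝ} (hEW : 0 < EW) (hEH : 0 < EH) (e : ι ↪ μ) {Z : Matrix ι κ ℝ}
    (hZ : nuclearNorm Z ≤ √(EW * EH)) :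
    ∃ (W : Matrix ι μ ℝ) (H : Matrix μ κ ℝ), W * H = Z ∧ frobeniusSq W ≤ EW ∧
      frobeniusSq H ≤ EH ∧ (frobeniusSq W = EW → nuclearNorm Z = √(EW * EH)) := by
  have ht : 0 < √(EW / EH) := by positivity
  obtain ⟨W, H, h1, h2, h3⟩ := exists_factorization e Z ht
  have h4 := sqrt_div_mul_sqrt_mul hEW hEH
  have h5 := sqrt_div_mul_sqrt_mul hEH hEW
  rw [mul_comm EH EW] at h5
  have h6 : (√(EW / EH))⁻¹ = √(EH / EW) := by rw [← Real.sqrt_inv, inv_div]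
  refine ⟨W, H, h1, ?_, ?_, fun h => ?_⟩
  · rw [h2]
    exact (mul_le_mul_of_nonneg_left hZ ht.le).trans_eq h4
  · rw [h3, h6]
    exact (mul_le_mul_of_nonneg_left hZ (Real.sqrt_nonneg _)).trans_eq h5
  · exact mul_left_cancel₀ ht.ne' (by rw [← h2, h, h4])

theorem convex_nuclearNorm_le [DecidableEq ι] [DecidableEq κ] {EW EH : ℝ} (hEW : 0 < EW)
    (hEH : 0 < EH) : Convex ℝ {Z : Matrix ι κ ℝ | nuclearNorm Z ≤ √(EW * EH)} := by
  intro Z₁ h₁ Z₂ h₂ a b ha hb hab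
  obtain ⟨W₁, H₁, e₁, w₁, k₁, -⟩ :=
    exists_factorization_of_nuclearNorm_le hEW hEH (Function.Embedding.refl ι) h₁
  obtain ⟨W₂, H₂, e₂, w₂, k₂, -⟩ :=
    exists_factorization_of_nuclearNorm_le hEW hEH (Function.Embedding.refl ι) h₂
  -- Concatenating the scaled factors doubles the inner dimension, realizes the convex combination
  -- and averages the squared norms.
  have hprod : Matrix.fromCols (√a • W₁) (√b • W₂) * Matrix.fromRows (√a • H₁) (√b • H₂) =
      a • Z₁ + b • Z₂ := by
    rw [Matrix.fromCols_mul_fromRows, Matrix.smul_mul, Matrix.mul_smul, smul_smul, e₁,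
      Matrix.smul_mul, Matrix.mul_smul, smul_smul, e₂, Real.mul_self_sqrt ha,
      Real.mul_self_sqrt hb]
  have hcomb {x y E : ℝ} (hx : x ≤ E) (hy : y ≤ E) : √a ^ 2 * x + √b ^ 2 * y ≤ E := by
    rw [Real.sq_sqrt ha, Real.sq_sqrt hb]
    calc a * x + b * y ≤ a * E + b * E := by gcongr
      _ = E := by rw [← add_mul, hab, one_mul]
  rw [Set.mem_ofPred_eq, ← hprod]
  apply nuclearNorm_mul_le hEW hEH
  · rw [show frobeniusSq (Matrix.fromCols (√a • W₁) (√b • W₂)) =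
        frobeniusSq (√a • W₁) + frobeniusSq (√b • W₂) by
      simp [frobeniusSq, Finset.sum_add_distrib], frobeniusSq_smul, frobeniusSq_smul]
    exact hcomb w₁ w₂
  · rw [show frobeniusSq (Matrix.fromRows (√a • H₁) (√b • H₂)) =
        frobeniusSq (√a • H₁) + frobeniusSq (√b • H₂) by
      simp [frobeniusSq], frobeniusSq_smul, frobeniusSq_smul]
    exact hcomb k₁ k₂

theorem nuclearNorm_submatrix_right [DecidableEq ι] [DecidableEq κ] (Z : Matrix ι κ ℝ)
    (e : κ ≃ κ) : nuclearNorm (Z.submatrix id e) = nuclearNorm Z := by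
  rw [nuclearNorm_eq_trace_sqrt, nuclearNorm_eq_trace_sqrt, Matrix.transpose_submatrix,
    Matrix.submatrix_mul_equiv, Matrix.submatrix_id_id]

theorem sqrt_submatrix [DecidableEq ι] {M : Matrix ι ι ℝ} (hM : 0 ≤ M) (e : ι ≃ ι) :
    CFC.sqrt (M.submatrix e e) = (CFC.sqrt M).submatrix e e := by
  apply CFC.sqrt_unique
  · rw [Matrix.submatrix_mul_equiv, CFC.sqrt_mul_sqrt_self M hM]
  · have := CFC.sqrt_nonneg M
    rw [Matrix.nonneg_iff_posSemidef] at this ⊢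
    exact this.submatrix e

end Factorization

end LayerPeeled

namespace LayerPeeled

/-! ### Convexity of softmax cross-entropy, strict modulo constants. -/

section CrossEntropy

variable {m : ℕ}

theorem softmax_sub_const (u : Fin m → ℝ) (c : ℝ) : softmax (fun k => u k - c) = softmax u := by
  funext k
  simp only [softmax, Real.exp_sub, ← Finset.sum_div]
  exact div_div_div_cancel_right₀ (Real.exp_pos c).ne' _ _

theorem crossEntropy_softmax_comp (u p : Fin m → ℝ) (e : Fin m ≃ Fin m) :
    crossEntropy (softmax (u ∘ e)) (p ∘ e) = crossEntropy (softmax u) p := by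
  simp only [crossEntropy, softmax, Function.comp_apply, e.sum_comp fun l => Real.exp (u l)]
  rw [e.sum_comp fun k => p k * Real.log (Real.exp (u k) / ∑ l, Real.exp (u l))]

theorem sum_sub_mul_sub (q p u v : Fin m → ℝ) :
    ∑ k, (q k - p k) * (v k - u k) =
      ∑ k, q k * (v k - u k) - (∑ k, p k * v k - ∑ k, p k * u k) := by
  simp only [← Finset.sum_sub_distrib]
  exact Finset.sum_congr rfl fun k _ => by ring

variable [NeZero m]

theorem sum_exp_pos (u : Fin m → ℝ) : 0 < ∑ l, Real.exp (u l) :=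
  Finset.sum_pos (fun _ _ => Real.exp_pos _) Finset.univ_nonempty

theorem softmax_pos (u : Fin m → ℝ) (k : Fin m) : 0 < softmax u k :=
  div_pos (Real.exp_pos _) (sum_exp_pos u)

theorem sum_softmax (u : Fin m → ℝ) : ∑ k, softmax u k = 1 := by
  simp only [softmax]
  rw [← Finset.sum_div, div_self (sum_exp_pos u).ne']

theorem crossEntropy_softmax (u : Fin m → ℝ) {p : Fin m → ℝ} (hp : ∑ k, p k = 1) :
    crossEntropy (softmax u) p = Real.log (∑ l, Real.exp (u l)) - ∑ k, p k * u k := by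
  have (k : Fin m) : p k * Real.log (softmax u k) =
      p k * u k - p k * Real.log (∑ l, Real.exp (u l)) := by
    rw [softmax, Real.log_div (Real.exp_pos _).ne' (sum_exp_pos u).ne', Real.log_exp, mul_sub]
  simp only [crossEntropy, this, Finset.sum_sub_distrib, ← Finset.sum_mul, hp]
  ring

theorem softmax_mul_exp (u v : Fin m → ℝ) (k : Fin m) :
    softmax u k * Real.exp (v k - u k -
      (Real.log (∑ l, Real.exp (v l)) - Real.log (∑ l, Real.exp (u l)))) = softmax v k := by
  have hu := sum_exp_pos u
  have hv := sum_exp_pos v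
  rw [Real.exp_sub, Real.exp_sub, Real.exp_sub, Real.exp_log hu, Real.exp_log hv, softmax, softmax]
  field_simp

theorem sum_softmax_mul_tangent (u v : Fin m → ℝ) (s : ℝ) :
    ∑ k, softmax u k * (v k - u k - s + 1) = ∑ k, softmax u k * (v k - u k) - s + 1 := by
  have (k : Fin m) : softmax u k * (v k - u k - s + 1) =
      softmax u k * (v k - u k) + softmax u k * (1 - s) := by ring
  simp only [this, Finset.sum_add_distrib, ← Finset.sum_mul, sum_softmax]
  ring

/-- Average `x + 1 ≤ exp x` against `softmax u`, with `x` equal to `v k - u k` minus the change in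
log-sum-exp; the exponentials then average to `∑ k, softmax v k = 1`. -/
theorem crossEntropy_tangent_le {p : Fin m → ℝ} (hp : ∑ k, p k = 1) (u v : Fin m → ℝ) :
    crossEntropy (softmax u) p + ∑ k, (softmax u k - p k) * (v k - u k) ≤
      crossEntropy (softmax v) p := by
  rw [crossEntropy_softmax u hp, crossEntropy_softmax v hp, sum_sub_mul_sub]
  have h := Finset.sum_le_sum fun k (_ : k ∈ Finset.univ) =>
    mul_le_mul_of_nonneg_left (Real.add_one_le_exp (v k - u k -
      (Real.log (∑ l, Real.exp (v l)) - Real.log (∑ l, Real.exp (u l))))) (softmax_pos u k).le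
  simp only [softmax_mul_exp, sum_softmax_mul_tangent, sum_softmax] at h
  linarith

/-- All softmax weights are positive, so equality forces `x = 0` in every `x + 1 ≤ exp x`. -/
theorem exists_const_of_crossEntropy_le_tangent {p : Fin m → ℝ} (hp : ∑ k, p k = 1)
    {u v : Fin m → ℝ} (h : crossEntropy (softmax v) p ≤
      crossEntropy (softmax u) p + ∑ k, (softmax u k - p k) * (v k - u k)) :
    ∃ s, ∀ k, v k - u k = s := by
  rw [crossEntropy_softmax u hp, crossEntropy_softmax v hp, sum_sub_mul_sub] at h
  refine ⟨Real.log (∑ l, Real.exp (v l)) - Real.log (∑ l, Real.exp (u l)), ?_⟩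
  by_contra! hne
  obtain ⟨k₀, hk₀⟩ := hne
  have h' := Finset.sum_lt_sum (fun k (_ : k ∈ Finset.univ) =>
    mul_le_mul_of_nonneg_left (Real.add_one_le_exp (v k - u k -
      (Real.log (∑ l, Real.exp (v l)) - Real.log (∑ l, Real.exp (u l))))) (softmax_pos u k).le)
    ⟨k₀, Finset.mem_univ _, mul_lt_mul_of_pos_left
      (Real.add_one_lt_exp (sub_ne_zero.2 hk₀)) (softmax_pos u k₀)⟩
  simp only [softmax_mul_exp, sum_softmax_mul_tangent, sum_softmax] at h'
  linarith

theorem convexOn_crossEntropy_softmax {p : Fin m → ℝ} (hp : ∑ k, p k = 1) :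
    ConvexOn ℝ Set.univ fun u : Fin m → ℝ => crossEntropy (softmax u) p := by
  refine ⟨convex_univ, fun x _ y _ a b ha hb hab => ?_⟩
  set w := a • x + b • y
  have hx := mul_le_mul_of_nonneg_left (crossEntropy_tangent_le hp w x) ha
  have hy := mul_le_mul_of_nonneg_left (crossEntropy_tangent_le hp w y) hb
  have h0 : a * ∑ k, (softmax w k - p k) * (x k - w k) +
      b * ∑ k, (softmax w k - p k) * (y k - w k) = 0 := by
    rw [Finset.mul_sum, Finset.mul_sum, ← Finset.sum_add_distrib]
    refine Finset.sum_eq_zero fun k _ => ?_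
    have : w k = a * x k + b * y k := rfl
    rw [this]
    linear_combination (softmax w k - p k) * (a * x k + b * y k) * (-hab)
  have h1 : (a + b) * crossEntropy (softmax w) p = crossEntropy (softmax w) p := by
    rw [hab, one_mul]
  simp only [smul_eq_mul]
  linarith

/-- The softmax cross-entropy is strictly convex up to additive constants. -/
theorem exists_const_of_crossEntropy_midpoint {p : Fin m → ℝ} (hp : ∑ k, p k = 1)
    {x y : Fin m → ℝ}
    (h : (1 / 2 : ℝ) * crossEntropy (softmax x) p + (1 / 2 : ℝ) * crossEntropy (softmax y) p ≤
      crossEntropy (softmax ((1 / 2 : ℝ) • x + (1 / 2 : ℝ) • y)) p) :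
    ∃ s, ∀ k, x k - y k = s := by
  set w := (1 / 2 : ℝ) • x + (1 / 2 : ℝ) • y
  have hw (k : Fin m) : w k = 1 / 2 * x k + 1 / 2 * y k := rfl
  have hy := crossEntropy_tangent_le hp w y
  -- The linear terms at the midpoint are opposite, so the tangent bound at `y` and `h` yield the
  -- reverse tangent bound at `x`.
  have h0 : ∑ k, (softmax w k - p k) * (x k - w k) =
      -∑ k, (softmax w k - p k) * (y k - w k) := by
    rw [← Finset.sum_neg_distrib]
    exact Finset.sum_congr rfl fun k _ => by rw [hw]; ring
  obtain ⟨s, hs⟩ := exists_const_of_crossEntropy_le_tangent hp (u := w) (v := x) (by linarith)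
  exact ⟨2 * s, fun k => by rw [← hs k, hw]; ring⟩

end CrossEntropy

end LayerPeeled

namespace LayerPeeled

/-! ### Shift symmetry of orbit matrices and the reduced program. -/

section CyclicShift

variable {m b : ℕ}

theorem nuclearNorm_orbitBlocks (τ : Fin b → Equiv.Perm (Fin m)) (x : Fin b → Fin m → ℝ) :
    nuclearNorm (orbitBlocks τ x) = nuclearNorm (blockCirculant x) := by
  rw [← nuclearNorm_submatrix_right (blockCirculant x) (Equiv.prodShear (Equiv.refl _) τ)]
  congr 1

/-- The objective of the layer-peeled program as a function of the logit matrix. -/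
noncomputable def logitLoss {κ : Type*} [Fintype κ] (Y Z : Matrix (Fin m) κ ℝ) : ℝ :=
  ∑ c, crossEntropy (softmax (Z.col c)) (Y.col c)

theorem logitLoss_submatrix {κ : Type*} [Fintype κ] (Y Z : Matrix (Fin m) κ ℝ)
    (e : Fin m ≃ Fin m) (f : κ ≃ κ) :
    logitLoss (Y.submatrix e f) (Z.submatrix e f) = logitLoss Y Z := by
  unfold logitLoss
  rw [← f.sum_comp fun c => crossEntropy (softmax (Z.col c)) (Y.col c)]
  exact Finset.sum_congr rfl fun c _ =>
    crossEntropy_softmax_comp (Z.col (f c)) (Y.col (f c)) e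

variable [NeZero m]

theorem cyclicShift_mulVec (x : Fin m → ℝ) (k : Fin m) :
    (cyclicShift m).mulVec x k = x (k - 1) := by
  have h (j : Fin m) : ((k : ℕ) = ((j : ℕ) + 1) % m) ↔ j = k - 1 := by
    rw [eq_sub_iff_add_eq, Fin.ext_iff, Fin.val_add, Fin.coe_ofNat_eq_mod, Nat.add_mod_mod, eq_comm]
  simp [cyclicShift, Matrix.mulVec, dotProduct, h]

theorem cyclicShift_pow_mulVec (x : Fin m → ℝ) (n : ℕ) (k : Fin m) :
    (cyclicShift m ^ n).mulVec x k = x (k - Fin.ofNat m n) := by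
  induction n generalizing k with
  | zero => simp
  | succ n ih =>
    rw [pow_succ', ← Matrix.mulVec_mulVec, cyclicShift_mulVec, ih]
    congr 1
    have : Fin.ofNat m (n + 1) = Fin.ofNat m n + 1 := by
      ext; simp [Fin.val_add, Fin.coe_ofNat_eq_mod]
    rw [this]
    abel

theorem orbitBlocks_apply (τ : Fin b → Equiv.Perm (Fin m)) (x : Fin b → Fin m → ℝ) (k : Fin m)
    (c : Fin b × Fin m) : orbitBlocks τ x k c = x c.1 (k - τ c.1 c.2) := by
  simp [orbitBlocks, cyclicShift_pow_mulVec]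

theorem isCirculant_of_sub {A : Matrix (Fin m) (Fin m) ℝ}
    (h : ∀ s k l, A (k - s) (l - s) = A k l) : IsCirculant A := by
  refine ⟨A.col 0, fun j => funext fun k => ?_⟩
  rw [cyclicShift_pow_mulVec]
  simpa using (h j k j).symm

/-- The reordering of columns that accompanies a cyclic shift of the rows of an orbit matrix. -/
def orbitPerm (τ : Fin b → Equiv.Perm (Fin m)) (s : Fin m) : Equiv.Perm (Fin b × Fin m) where
  toFun c := (c.1, (τ c.1).symm (τ c.1 c.2 - s))
  invFun c := (c.1, (τ c.1).symm (τ c.1 c.2 + s))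
  left_inv c := by simp
  right_inv c := by simp

theorem orbitBlocks_submatrix (τ : Fin b → Equiv.Perm (Fin m)) (x : Fin b → Fin m → ℝ)
    (s : Fin m) :
    (orbitBlocks τ x).submatrix (Equiv.subRight s) (orbitPerm τ s) = orbitBlocks τ x := by
  ext k c
  simp [orbitBlocks_apply, orbitPerm]

theorem eq_orbitBlocks_of_submatrix {τ : Fin b → Equiv.Perm (Fin m)}
    {Z : Matrix (Fin m) (Fin b × Fin m) ℝ}
    (h : ∀ s, Z.submatrix (Equiv.subRight s) (orbitPerm τ s) = Z) :
    Z = orbitBlocks τ fun i k => Z k (i, (τ i).symm 0) := by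
  ext k c
  rw [orbitBlocks_apply]
  -- This shift takes column `c` to the column of its block with exponent `0`, where the generator
  -- sits.
  conv_lhs => rw [← h (τ c.1 c.2)]
  simp [orbitPerm]

theorem convex_reducedFeasible {EW EH : ℝ} (hEW : 0 < EW) (hEH : 0 < EH) :
    Convex ℝ (reducedFeasible m b EW EH) := by
  intro x hx y hy s t hs ht hst
  have h := convex_nuclearNorm_le (ι := Fin m) (κ := Fin b × Fin m) hEW hEH hx hy hs ht hst
  have e : blockCirculant (s • x + t • y) = s • blockCirculant x + t • blockCirculant y := by
    ext k c
    simp [blockCirculant, orbitBlocks_apply]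
  simpa only [reducedFeasible, Set.mem_ofPred_eq, e] using h

theorem convexOn_reducedObjective {y : Fin b → Fin m → ℝ} (hy : ∀ i, ∑ k, y i k = 1) :
    ConvexOn ℝ Set.univ (reducedObjective y) := by
  refine ⟨convex_univ, fun u _ v _ s t hs ht hst => ?_⟩
  simp only [reducedObjective, smul_eq_mul, Finset.mul_sum, ← Finset.sum_add_distrib]
  exact Finset.sum_le_sum fun i _ => (convexOn_crossEntropy_softmax (hy i)).2
    (Set.mem_univ (u i)) (Set.mem_univ (v i)) hs ht hst

/-- In each column, target and logits undergo the same shift, so a block contributes `m` equal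
terms. -/
theorem logitLoss_orbitBlocks (τ : Fin b → Equiv.Perm (Fin m)) (y z : Fin b → Fin m → ℝ) :
    logitLoss (orbitBlocks τ y) (orbitBlocks τ z) = m * reducedObjective y z := by
  have h (c : Fin b × Fin m) : crossEntropy (softmax ((orbitBlocks τ z).col c))
      ((orbitBlocks τ y).col c) = crossEntropy (softmax (z c.1)) (y c.1) := by
    rw [← crossEntropy_softmax_comp (z c.1) (y c.1) (Equiv.subRight (τ c.1 c.2))]
    congr 2 <;> funext k <;> simp [orbitBlocks_apply]
  simp only [logitLoss, h, Fintype.sum_prod_type, reducedObjective, Finset.mul_sum]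
  simp

end CyclicShift

end LayerPeeled

namespace LayerPeeled

/-! ### Uniqueness and symmetry of the optimal logits. -/

section Minimizers

variable {m d : ℕ} {κ : Type*} [Fintype κ]

theorem IsMinimizer.logitLoss_le [DecidableEq κ] {Y : Matrix (Fin m) κ ℝ} {EW EH : ℝ}
    {W : Matrix (Fin m) (Fin d) ℝ} {H : Matrix (Fin d) κ ℝ} (h : IsMinimizer Y EW EH W H)
    (hd : m ≤ d) (hEW : 0 < EW) (hEH : 0 < EH) {Z : Matrix (Fin m) κ ℝ}
    (hZ : nuclearNorm Z ≤ √(EW * EH)) : logitLoss Y (W * H) ≤ logitLoss Y Z := by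
  obtain ⟨W', H', rfl, hW, hH, -⟩ :=
    exists_factorization_of_nuclearNorm_le hEW hEH (Fin.castLEEmb hd) hZ
  exact isMinOn_iff.1 h.2 (W', H') ⟨hW, hH⟩

theorem IsMinimizer.of_logitLoss_le {Y : Matrix (Fin m) κ ℝ} {EW EH : ℝ}
    {W W' : Matrix (Fin m) (Fin d) ℝ} {H H' : Matrix (Fin d) κ ℝ} (h : IsMinimizer Y EW EH W H)
    (hW : frobeniusSq W' ≤ EW) (hH : frobeniusSq H' ≤ EH)
    (hle : logitLoss Y (W' * H') ≤ logitLoss Y (W * H)) : IsMinimizer Y EW EH W' H' :=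
  ⟨⟨hW, hH⟩, fun _ hp => le_trans hle (h.2 hp)⟩

/-- The balanced factorization of `W * H` is again a minimizer, so activity applies to it. -/
theorem IsMinimizer.nuclearNorm_eq [DecidableEq κ] {Y : Matrix (Fin m) κ ℝ} {EW EH : ℝ}
    {W : Matrix (Fin m) (Fin d) ℝ} {H : Matrix (Fin d) κ ℝ} (h : IsMinimizer Y EW EH W H)
    (hd : m ≤ d) (hactive : ActiveConstraints d Y EW EH) :
    nuclearNorm (W * H) = √(EW * EH) := by
  obtain ⟨hEW, hEH, hact⟩ := hactive
  obtain ⟨W', H', e, hW, hH, heq⟩ :=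
    exists_factorization_of_nuclearNorm_le hEW hEH (Fin.castLEEmb hd)
      (nuclearNorm_mul_le hEW hEH h.1.1 h.1.2)
  exact heq (hact W' H' (h.of_logitLoss_le hW hH (by rw [e]))).1

theorem frobeniusSq_sub_col_mean [NeZero m] (W : Matrix (Fin m) (Fin d) ℝ) :
    frobeniusSq (Matrix.of fun k j => W k j - (∑ l, W l j) / m) =
      frobeniusSq W - ∑ j, (∑ l, W l j) ^ 2 / m := by
  have hm : (m : ℝ) ≠ 0 := Nat.cast_ne_zero.2 (NeZero.ne m)
  unfold frobeniusSq
  rw [Finset.sum_comm, Finset.sum_comm (f := fun k j => W k j ^ 2), ← Finset.sum_sub_distrib]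
  refine Finset.sum_congr rfl fun j _ => ?_
  simp only [Matrix.of_apply, sub_sq, Finset.sum_add_distrib, Finset.sum_sub_distrib,
    ← Finset.sum_mul, ← Finset.mul_sum, Finset.sum_const, Finset.card_univ, Fintype.card_fin,
    nsmul_eq_mul]
  field_simp
  ring

theorem IsMinimizer.sum_col_eq_zero [NeZero m] {Y : Matrix (Fin m) κ ℝ} {EW EH : ℝ}
    {W : Matrix (Fin m) (Fin d) ℝ} {H : Matrix (Fin d) κ ℝ} (h : IsMinimizer Y EW EH W H)
    (hactive : ActiveConstraints d Y EW EH) (c : κ) : ∑ k, (W * H) k c = 0 := by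
  have hm : (0 : ℝ) < m := Nat.cast_pos.2 (NeZero.pos m)
  set W' : Matrix (Fin m) (Fin d) ℝ := Matrix.of fun k j => W k j - (∑ l, W l j) / m
  have hW' : frobeniusSq W' = frobeniusSq W - ∑ j, (∑ l, W l j) ^ 2 / m :=
    frobeniusSq_sub_col_mean W
  have hnn (j : Fin d) : 0 ≤ (∑ l, W l j) ^ 2 / (m : ℝ) := by positivity
  have hcol (c : κ) : (W' * H).col c =
      fun k => (W * H).col c k - ∑ j, (∑ l, W l j) / m * H j c := by
    funext k
    simp [W', Matrix.mul_apply, sub_mul]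
  have hmin : IsMinimizer Y EW EH W' H := by
    refine h.of_logitLoss_le ?_ h.1.2 (le_of_eq ?_)
    · rw [hW']
      linarith [h.1.1, Finset.sum_nonneg fun j (_ : j ∈ Finset.univ) => hnn j]
    · simp only [logitLoss, hcol, softmax_sub_const]
  -- Both `W` and its centred version are optimal, so both have squared norm `EW`.
  have hzero : ∑ j, (∑ l, W l j) ^ 2 / (m : ℝ) = 0 := by
    linarith [(hactive.2.2 W' H hmin).1, (hactive.2.2 W H h).1]
  rw [Finset.sum_eq_zero_iff_of_nonneg fun j _ => hnn j] at hzero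
  have hcs (j : Fin d) : ∑ l, W l j = 0 := by
    simpa [hm.ne'] using hzero j (Finset.mem_univ j)
  simp only [Matrix.mul_apply]
  rw [Finset.sum_comm]
  simp [← Finset.sum_mul, hcs]

/-- All minimizers have the same logit matrix. -/
theorem IsMinimizer.mul_eq_mul [NeZero m] [DecidableEq κ] {Y : Matrix (Fin m) κ ℝ} {EW EH : ℝ}
    {W W' : Matrix (Fin m) (Fin d) ℝ} {H H' : Matrix (Fin d) κ ℝ}
    (hY : ∀ c, ∑ k, Y k c = 1) (hd : m ≤ d) (hactive : ActiveConstraints d Y EW EH)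
    (h : IsMinimizer Y EW EH W H) (h' : IsMinimizer Y EW EH W' H') : W' * H' = W * H := by
  have hEW := hactive.1
  have hEH := hactive.2.1
  have hn := nuclearNorm_mul_le hEW hEH h.1.1 h.1.2
  have hn' := nuclearNorm_mul_le hEW hEH h'.1.1 h'.1.2
  have hmid := h.logitLoss_le hd hEW hEH (convex_nuclearNorm_le hEW hEH hn' hn
    (by norm_num : (0 : ℝ) ≤ 1 / 2) (by norm_num : (0 : ℝ) ≤ 1 / 2) (by norm_num))
  have heq : logitLoss Y (W' * H') = logitLoss Y (W * H) :=
    (h'.logitLoss_le hd hEW hEH hn).antisymm (h.logitLoss_le hd hEW hEH hn')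
  have hs := h.sum_col_eq_zero hactive
  have hs' := h'.sum_col_eq_zero hactive
  set Z := W * H
  set Z' := W' * H'
  have hle (c : κ) : crossEntropy (softmax (((1 / 2 : ℝ) • Z' + (1 / 2 : ℝ) • Z).col c)) (Y.col c) ≤
      1 / 2 * crossEntropy (softmax (Z'.col c)) (Y.col c) +
        1 / 2 * crossEntropy (softmax (Z.col c)) (Y.col c) :=
    (convexOn_crossEntropy_softmax (hY c)).2 (Set.mem_univ (Z'.col c)) (Set.mem_univ (Z.col c))
      (by norm_num) (by norm_num) (by norm_num)
  have hsum : ∑ c, crossEntropy (softmax (((1 / 2 : ℝ) • Z' + (1 / 2 : ℝ) • Z).col c)) (Y.col c) =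
      ∑ c, (1 / 2 * crossEntropy (softmax (Z'.col c)) (Y.col c) +
        1 / 2 * crossEntropy (softmax (Z.col c)) (Y.col c)) := by
    refine (Finset.sum_le_sum fun c _ => hle c).antisymm ?_
    rw [Finset.sum_add_distrib, ← Finset.mul_sum, ← Finset.mul_sum]
    unfold logitLoss at hmid heq
    linarith
  have hpt := (Finset.sum_eq_sum_iff_of_le fun c _ => hle c).1 hsum
  ext k c
  obtain ⟨s, hsc⟩ := exists_const_of_crossEntropy_midpoint (hY c) (x := Z'.col c) (y := Z.col c)
    (hpt c (Finset.mem_univ c)).ge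
  -- The columns differ by a constant; zero column sums make it zero.
  have h0 : ∑ k, (Z'.col c k - Z.col c k) = 0 := by
    rw [Finset.sum_sub_distrib]
    exact sub_eq_zero.2 ((hs' c).trans (hs c).symm)
  simp only [hsc, Finset.sum_const, Finset.card_univ, Fintype.card_fin, nsmul_eq_mul,
    mul_eq_zero, Nat.cast_eq_zero, NeZero.ne m, false_or] at h0
  have := hsc k
  rw [h0] at this
  exact sub_eq_zero.1 this

theorem IsMinimizer.submatrix {Y : Matrix (Fin m) κ ℝ} {EW EH : ℝ}
    {W : Matrix (Fin m) (Fin d) ℝ} {H : Matrix (Fin d) κ ℝ} (h : IsMinimizer Y EW EH W H)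
    {e : Fin m ≃ Fin m} {f : κ ≃ κ} (hY : Y.submatrix e f = Y) :
    IsMinimizer Y EW EH (W.submatrix e id) (H.submatrix id f) := by
  refine h.of_logitLoss_le (le_of_eq_of_le ?_ h.1.1) (le_of_eq_of_le ?_ h.1.2) (le_of_eq ?_)
  · exact e.sum_comp fun i => ∑ j, W i j ^ 2
  · exact Finset.sum_congr rfl fun i _ => f.sum_comp fun j => H i j ^ 2
  · rw [← logitLoss_submatrix Y (W * H) e f, hY]
    rfl

end Minimizers

end LayerPeeled

/-! ### Assembly of the theorem. -/

theorem mainTheorem6 (m d b : ℕ) (hd : m ≤ d) (EW EH : ℝ)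
    (y : Fin b → Fin m → ℝ) (hy : ∀ i, y i ∈ stdSimplex ℝ (Fin m))
    (hnonuniform : ∃ i, y i ≠ fun _ => (1 : ℝ) / m)
    (τ : Fin b → Equiv.Perm (Fin m))
    (Y : Matrix (Fin m) (Fin b × Fin m) ℝ) (hY : Y = LayerPeeled.orbitBlocks τ y)
    (hactive : LayerPeeled.ActiveConstraints d Y EW EH)
    (W : Matrix (Fin m) (Fin d) ℝ) (H : Matrix (Fin d) (Fin b × Fin m) ℝ)
    (hWH : LayerPeeled.IsMinimizer Y EW EH W H) :
    (∃ z : Fin b → Fin m → ℝ,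
      W * H = LayerPeeled.orbitBlocks τ z ∧
      z ∈ LayerPeeled.reducedFeasible m b EW EH ∧
      IsMinOn (LayerPeeled.reducedObjective y) (LayerPeeled.reducedFeasible m b EW EH) z) ∧
    ConvexOn ℝ Set.univ (LayerPeeled.reducedObjective y) ∧
    Convex ℝ (LayerPeeled.reducedFeasible m b EW EH) ∧
    W * W.transpose = √(EW / EH) • CFC.sqrt ((W * H) * (W * H).transpose) ∧
    LayerPeeled.IsCirculant (W * W.transpose) := by
  open LayerPeeled in
  have hm0 : m ≠ 0 := by
    rintro rfl
    -- An index is all that is needed: no probability vector exists on `Fin 0`.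
    obtain ⟨i, -⟩ := hnonuniform
    simpa using (hy i).2
  have : NeZero m := ⟨hm0⟩
  have hEW := hactive.1
  have hEH := hactive.2.1
  have hYsum (c : Fin b × Fin m) : ∑ k, Y k c = 1 := by
    simp only [hY, orbitBlocks_apply]
    rw [← (hy c.1).2]
    exact (Equiv.subRight (τ c.1 c.2)).sum_comp (y c.1)
  have hinv (s : Fin m) :
      (W * H).submatrix (Equiv.subRight s) (orbitPerm τ s) = W * H :=
    hWH.mul_eq_mul hYsum hd hactive (hWH.submatrix (by rw [hY, orbitBlocks_submatrix]))
  have hWW : W * W.transpose = √(EW / EH) • CFC.sqrt ((W * H) * (W * H).transpose) :=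
    mul_transpose_eq_of_nuclearNorm_eq hEW hEH hWH.1.1 hWH.1.2 (hWH.nuclearNorm_eq hd hactive)
  refine ⟨⟨_, eq_orbitBlocks_of_submatrix hinv, ?_, fun x hx => ?_⟩,
    convexOn_reducedObjective fun i => (hy i).2, convex_reducedFeasible hEW hEH, hWW, ?_⟩
  · rw [reducedFeasible, Set.mem_ofPred_eq, ← nuclearNorm_orbitBlocks τ,
      ← eq_orbitBlocks_of_submatrix hinv]
    exact nuclearNorm_mul_le hEW hEH hWH.1.1 hWH.1.2
  · have hx' : nuclearNorm (orbitBlocks τ x) ≤ √(EW * EH) := by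
      rw [nuclearNorm_orbitBlocks]
      exact hx
    have h := hWH.logitLoss_le hd hEW hEH hx'
    rw [eq_orbitBlocks_of_submatrix hinv, hY, logitLoss_orbitBlocks, logitLoss_orbitBlocks] at h
    exact le_of_mul_le_mul_left h (Nat.cast_pos.2 (NeZero.pos m))
  · refine isCirculant_of_sub fun s k l => ?_
    have h1 : ((W * H) * (W * H).transpose).submatrix (Equiv.subRight s) (Equiv.subRight s) =
        (W * H) * (W * H).transpose := by
      conv_rhs => rw [← hinv s]
      rw [Matrix.transpose_submatrix, Matrix.submatrix_mul_equiv]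
    have h2 := sqrt_submatrix (mul_transpose_self_nonneg (W * H)) (Equiv.subRight s)
    rw [h1] at h2
    rw [hWW, Matrix.smul_apply, Matrix.smul_apply]
    congr 1
    conv_rhs => rw [h2]
    rfl
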